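/- For a real polynomial $p$ in one variable write $\|p\|_\infty := \sup_{|x|\le 1}|p(x)|$. Let $n \ge 1$ be an integer and let $p_1,\dots,p_n$ be real polynomials of degree at most $n$ with $\|p_i\|_\infty \le 1$ for every $i \in \{1,\dots,n\}$. Then there exist signs $x_1,\dots,x_n \in \{-1,1\}$ such that \[\Big\|\sum_{i=1}^n x_i p_i\Big\|_\infty < 30\sqrt{n}.\] -/

import Mathlib

/-- The Chebyshev norm `sup_{|x| ≤ 1} |p(x)|` of a real polynomial. The supremum is over a nonempty
set that is bounded above (see `bddAbove_abs_eval`), so it is a genuine least upper bound. -/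
noncomputable def chebyshevNorm (p : Polynomial ℝ) : ℝ :=
  sSup ((fun x : ℝ => |p.eval x|) '' {x : ℝ | |x| ≤ 1})

theorem bddAbove_abs_eval (p : Polynomial ℝ) :
    BddAbove ((fun x : ℝ => |p.eval x|) '' {x : ℝ | |x| ≤ 1}) := by
  have h : {x : ℝ | |x| ≤ 1} = Set.Icc (-1) 1 := by
    ext x
    simp [abs_le]
  rw [h]
  exact isCompact_Icc.bddAbove_image (p.continuous.abs.continuousOn)

/-! A polynomial of degree at most `n` is controlled by its values at the `4 n` nodes
`cos (2 π j / 4 n)`: on the unit circle it becomes a polynomial of degree `2 n`, and multiplying it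
by a geometric kernel of length `2 n` before applying Parseval's identity gives
`‖p‖ ≤ √2 max_j |p (cos (2 π j / 4 n))|`. It remains to balance `4 n` vectors of `[-1, 1]ⁿ`.

Among the points `x` of the cube at which all the linear forms stay below a barrier rising with
`‖x‖`, with a bounded inverse-square potential of the distances to the barrier, take one of largest
norm. If it has at least eight fractional coordinates, there is a direction in these coordinates
that is orthogonal to `x`, to the gradient of the potential and to the few forms closest to the
barrier, and along which, by averaging, the second derivative of the potential is small. A short
step in that direction raises the barrier by enough to pay for this second-order increase, and so
increases the norm, a contradiction. The at most seven remaining coordinates are rounded. -/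

open Polynomial Finset Filter Topology
open scoped RealInnerProductSpace ComplexConjugate

/-! ### Sampling at roots of unity -/

section Sampling

theorem sum_pow_mul_conj_pow {N : ℕ} {ζ : ℂ} (hζ : IsPrimitiveRoot ζ N) {a b : ℕ}
    (ha : a < N) (hb : b < N) :
    ∑ j ∈ range N, (ζ ^ j) ^ a * conj ((ζ ^ j) ^ b) = if a = b then (N : ℂ) else 0 := by
  have hζ0 : ζ ≠ 0 := hζ.ne_zero (by omega)
  have hconj : conj ζ = ζ⁻¹ := (Complex.inv_eq_conj (hζ.norm'_eq_one (by omega))).symm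
  have hterm (j : ℕ) : (ζ ^ j) ^ a * conj ((ζ ^ j) ^ b) = (ζ ^ a / ζ ^ b) ^ j := by
    simp only [map_pow, hconj, inv_pow, ← div_eq_mul_inv, div_pow, ← pow_mul, mul_comm]
  simp only [hterm]
  split_ifs with hab
  · simp [hab, hζ0]
  · have hne : ζ ^ a / ζ ^ b ≠ 1 := fun h =>
      hab (hζ.pow_inj ha hb ((div_eq_one_iff_eq (pow_ne_zero b hζ0)).1 h))
    have hpow : (ζ ^ a / ζ ^ b) ^ N = 1 := by
      rw [div_pow, ← pow_mul, ← pow_mul, mul_comm a, mul_comm b, pow_mul, pow_mul, hζ.pow_eq_one,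
        one_pow, one_pow, div_one]
    rw [geom_sum_eq hne, hpow, sub_self, zero_div]

theorem sum_norm_sq_eval_rootsOfUnity {N : ℕ} {ζ : ℂ} (hζ : IsPrimitiveRoot ζ N) {Q : ℂ[X]}
    (hQ : Q.natDegree < N) :
    ∑ j ∈ range N, ‖Q.eval (ζ ^ j)‖ ^ 2 = N * ∑ k ∈ range N, ‖Q.coeff k‖ ^ 2 := by
  have hexpand (j : ℕ) : (‖Q.eval (ζ ^ j)‖ ^ 2 : ℂ) = ∑ k ∈ range N, ∑ l ∈ range N,
      Q.coeff k * conj (Q.coeff l) * ((ζ ^ j) ^ k * conj ((ζ ^ j) ^ l)) := by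
    rw [← Complex.mul_conj', eval_eq_sum_range' hQ, map_sum, sum_mul_sum]
    refine sum_congr rfl fun k _ => sum_congr rfl fun l _ => ?_
    rw [map_mul]
    ring
  have hswap (k : ℕ) (hk : k ∈ range N) : ∑ j ∈ range N, ∑ l ∈ range N,
      Q.coeff k * conj (Q.coeff l) * ((ζ ^ j) ^ k * conj ((ζ ^ j) ^ l)) =
        N * (‖Q.coeff k‖ ^ 2 : ℂ) := by
    rw [sum_comm]
    simp only [← mul_sum]
    rw [sum_congr rfl fun l hl => by
      rw [sum_pow_mul_conj_pow hζ (mem_range.1 hk) (mem_range.1 hl)]]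
    simp only [mul_ite, mul_zero, sum_ite_eq, hk, if_true, Complex.mul_conj']
    ring
  have h : ((∑ j ∈ range N, ‖Q.eval (ζ ^ j)‖ ^ 2 : ℝ) : ℂ) =
      ((N * ∑ k ∈ range N, ‖Q.coeff k‖ ^ 2 : ℝ) : ℂ) := by
    push_cast
    rw [sum_congr rfl fun j _ => hexpand j, sum_comm, mul_sum]
    exact sum_congr rfl hswap
  exact_mod_cast h

theorem norm_sq_eval_le_sum_rootsOfUnity {N : ℕ} {ζ : ℂ} (hζ : IsPrimitiveRoot ζ N) {Q : ℂ[X]}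
    (hQ : Q.natDegree < N) {z : ℂ} (hz : ‖z‖ = 1) :
    ‖Q.eval z‖ ^ 2 ≤ ∑ j ∈ range N, ‖Q.eval (ζ ^ j)‖ ^ 2 := by
  have htriangle : ‖Q.eval z‖ ≤ ∑ k ∈ range N, ‖Q.coeff k‖ := by
    rw [eval_eq_sum_range' hQ]
    refine (norm_sum_le _ _).trans_eq ?_
    simp only [norm_mul, norm_pow, hz, one_pow, mul_one]
  calc ‖Q.eval z‖ ^ 2 ≤ (∑ k ∈ range N, ‖Q.coeff k‖) ^ 2 := by gcongr
    _ ≤ N * ∑ k ∈ range N, ‖Q.coeff k‖ ^ 2 := by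
      simpa using sq_sum_le_card_mul_sum_sq (s := range N) (f := fun k => ‖Q.coeff k‖)
    _ = ∑ j ∈ range N, ‖Q.eval (ζ ^ j)‖ ^ 2 := (sum_norm_sq_eval_rootsOfUnity hζ hQ).symm

/-- The geometric kernel `∑_{k < L} (conj z * X) ^ k`, which localises at a point `z` of the unit
circle: it takes the value `L` there, while its mean square over the `N`-th roots of unity, `L ≤ N`,
is only `L`. -/
noncomputable def geomKernel (L : ℕ) (z : ℂ) : ℂ[X] :=
  ∑ k ∈ range L, C (conj z ^ k) * X ^ k

theorem natDegree_geomKernel_lt {L : ℕ} (hL : L ≠ 0) (z : ℂ) : (geomKernel L z).natDegree < L := by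
  refine (natDegree_sum_le_of_forall_le (n := L - 1) _ _ fun k hk => ?_).trans_lt (by omega)
  exact (natDegree_C_mul_X_pow_le _ _).trans (Nat.le_sub_one_of_lt (mem_range.1 hk))

theorem eval_geomKernel_self (L : ℕ) {z : ℂ} (hz : ‖z‖ = 1) : (geomKernel L z).eval z = L := by
  have hz' : conj z * z = 1 := by rw [Complex.conj_mul', hz]; simp
  simp [geomKernel, eval_finsetSum, ← mul_pow, hz']

theorem sum_norm_sq_eval_geomKernel {N L : ℕ} {ζ : ℂ} (hζ : IsPrimitiveRoot ζ N) (hL : L ≠ 0)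
    (hLN : L ≤ N) {z : ℂ} (hz : ‖z‖ = 1) :
    ∑ j ∈ range N, ‖(geomKernel L z).eval (ζ ^ j)‖ ^ 2 = N * L := by
  have hcoeff (k : ℕ) : ‖(geomKernel L z).coeff k‖ ^ 2 = if k < L then 1 else 0 := by
    simp only [geomKernel, finsetSum_coeff, coeff_C_mul_X_pow, sum_ite_eq, mem_range]
    split_ifs <;> simp [hz]
  rw [sum_norm_sq_eval_rootsOfUnity hζ ((natDegree_geomKernel_lt hL z).trans_le hLN)]
  have hfilter : {k ∈ range N | k < L} = range L := by ext k; simp; omega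
  simp only [hcoeff, sum_boole, hfilter, card_range]

theorem mul_norm_sq_eval_le {N L : ℕ} {ζ : ℂ} (hζ : IsPrimitiveRoot ζ N) (hL : L ≠ 0) {P : ℂ[X]}
    (hP : P.natDegree + L ≤ N) {M : ℝ} (hM : ∀ j < N, ‖P.eval (ζ ^ j)‖ ≤ M) {z : ℂ}
    (hz : ‖z‖ = 1) : L * ‖P.eval z‖ ^ 2 ≤ N * M ^ 2 := by
  have hdeg : (P * geomKernel L z).natDegree < N :=
    natDegree_mul_le.trans_lt (by have := natDegree_geomKernel_lt hL z; omega)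
  have hL0 : (0 : ℝ) < L := by positivity
  refine le_of_mul_le_mul_left ?_ hL0
  calc L * (L * ‖P.eval z‖ ^ 2) = ‖(P * geomKernel L z).eval z‖ ^ 2 := by
        rw [eval_mul, eval_geomKernel_self L hz, norm_mul, Complex.norm_natCast]
        ring
    _ ≤ ∑ j ∈ range N, ‖(P * geomKernel L z).eval (ζ ^ j)‖ ^ 2 :=
        norm_sq_eval_le_sum_rootsOfUnity hζ hdeg hz
    _ ≤ ∑ j ∈ range N, M ^ 2 * ‖(geomKernel L z).eval (ζ ^ j)‖ ^ 2 := by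
        refine sum_le_sum fun j hj => ?_
        rw [eval_mul, norm_mul, mul_pow]
        gcongr
        exact hM j (mem_range.1 hj)
    _ = L * (N * M ^ 2) := by
        rw [← mul_sum, sum_norm_sq_eval_geomKernel hζ hL (by omega) hz]
        ring

theorem exists_eval_eq_pow_mul_eval_re {n : ℕ} {p : ℝ[X]} (hp : p.natDegree ≤ n) :
    ∃ P : ℂ[X], P.natDegree ≤ 2 * n ∧
      ∀ z : ℂ, ‖z‖ = 1 → P.eval z = z ^ n * (p.eval z.re : ℝ) := by
  refine induction_with_natDegree_le (fun p : ℝ[X] => ∃ P : ℂ[X], P.natDegree ≤ 2 * n ∧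
    ∀ z : ℂ, ‖z‖ = 1 → P.eval z = z ^ n * (p.eval z.re : ℝ)) n ⟨0, by simp⟩ ?_ ?_ p hp
  · intro k r _ hk
    refine ⟨C (r / 2 ^ k : ℂ) * X ^ (n - k) * (X ^ 2 + 1) ^ k, ?_, fun z hz => ?_⟩
    · have hk2 : ((X ^ 2 + 1 : ℂ[X]) ^ k).natDegree ≤ k * 2 :=
        natDegree_pow_le_of_le k (by compute_degree)
      refine natDegree_mul_le.trans ?_
      have := natDegree_C_mul_X_pow_le (r / 2 ^ k : ℂ) (n - k)
      omega
    · have hre : z ^ 2 + 1 = z * (2 * z.re) := by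
        have hconj : z * conj z = 1 := by rw [Complex.mul_conj', hz]; simp
        have hadd : z + conj z = 2 * z.re := by rw [Complex.add_conj]; push_cast; rfl
        rw [← hadd, mul_add, hconj, sq]
      simp only [eval_mul, eval_C, eval_pow, eval_X, eval_add, eval_one, hre]
      push_cast
      rw [← Nat.sub_add_cancel hk, pow_add, Nat.add_sub_cancel]
      rw [mul_pow z, mul_pow 2]
      field_simp
  · rintro f g - - ⟨P, hP, hPf⟩ ⟨Q, hQ, hQg⟩
    refine ⟨P + Q, natDegree_add_le_of_degree_le hP hQ, fun z hz => ?_⟩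
    rw [eval_add, hPf z hz, hQg z hz, eval_add]
    push_cast
    ring

theorem mul_sq_eval_le_of_cos_nodes {n N L : ℕ} (hL : L ≠ 0) (hN : 2 * n + L ≤ N) {p : ℝ[X]}
    (hp : p.natDegree ≤ n) {M : ℝ} (hM : ∀ j < N, |p.eval (Real.cos (2 * Real.pi * j / N))| ≤ M)
    {x : ℝ} (hx : |x| ≤ 1) : L * p.eval x ^ 2 ≤ N * M ^ 2 := by
  obtain ⟨P, hP, hPp⟩ := exists_eval_eq_pow_mul_eval_re hp
  have hcircle (θ : ℝ) : ‖P.eval (Complex.exp (θ * Complex.I))‖ = |p.eval (Real.cos θ)| := by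
    have hnorm := Complex.norm_exp_ofReal_mul_I θ
    rw [hPp _ hnorm, norm_mul, norm_pow, hnorm, one_pow, one_mul, Complex.norm_real,
      Complex.exp_ofReal_mul_I_re, Real.norm_eq_abs]
  have hnodes : ∀ j < N, ‖P.eval (Complex.exp (2 * Real.pi * Complex.I / N) ^ j)‖ ≤ M := by
    intro j hj
    rw [← Complex.exp_nat_mul]
    convert hM j hj using 1
    rw [← hcircle]
    push_cast
    congr 3
    ring
  have h := mul_norm_sq_eval_le (Complex.isPrimitiveRoot_exp N (by omega)) hL (by omega) hnodes
    (Complex.norm_exp_ofReal_mul_I (Real.arccos x))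
  rwa [hcircle, Real.cos_arccos (abs_le.1 hx).1 (abs_le.1 hx).2, sq_abs] at h

end Sampling

/-! ### Averaging over directions in the cube -/

section Averaging

variable {E ι : Type*} [NormedAddCommGroup E] [InnerProductSpace ℝ E] [Fintype ι]

theorem exists_norm_eq_one_finrank_mul_sum_le [FiniteDimensional ℝ E] [Nontrivial E] {w : ι → ℝ}
    (f : ι → StrongDual ℝ E) :
    ∃ u : E, ‖u‖ = 1 ∧
      Module.finrank ℝ E * ∑ j, w j * f j u ^ 2 ≤ ∑ j, w j * ‖f j‖ ^ 2 := by
  let b := stdOrthonormalBasis ℝ E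
  have hd : 0 < Module.finrank ℝ E := Module.finrank_pos
  have : Nonempty (Fin (Module.finrank ℝ E)) := ⟨⟨0, hd⟩⟩
  have hsum : ∑ k, ∑ j, w j * f j (b k) ^ 2 = ∑ j, w j * ‖f j‖ ^ 2 := by
    rw [sum_comm]
    simp only [← mul_sum, b.norm_dual]
  obtain ⟨k, -, hk⟩ := exists_min_image univ (fun k => ∑ j, w j * f j (b k) ^ 2) univ_nonempty
  refine ⟨b k, b.norm_eq_one k, ?_⟩
  simpa [hsum] using card_nsmul_le_sum univ _ _ hk

theorem finrank_le_finrank_orthogonal_add_card [FiniteDimensional ℝ E] (T : Finset E) :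
    Module.finrank ℝ E ≤ Module.finrank ℝ (Submodule.span ℝ (T : Set E))ᗮ + #T := by
  have hspan := finrank_span_finset_le_card (R := ℝ) T
  have hadd := (Submodule.span ℝ (T : Set E)).finrank_add_finrank_orthogonal
  rw [Set.finrank] at hspan
  omega

end Averaging

section Cube

variable {α : Type*} [Fintype α]

theorem inner_sq_le_card_mul_norm_sq {A : Finset α} {a u : EuclideanSpace ℝ α}
    (ha : ∀ i, |a i| ≤ 1) (hu : ∀ i ∉ A, u i = 0) : ⟪a, u⟫ ^ 2 ≤ #A * ‖u‖ ^ 2 := by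
  have hinner : ⟪a, u⟫ = ∑ i ∈ A, a i * u i := by
    rw [PiLp.inner_apply, sum_subset (subset_univ A) fun i _ hi => by rw [hu i hi, mul_zero]]
    exact sum_congr rfl fun i _ => by simp [mul_comm]
  have hsq : ∑ i ∈ A, a i ^ 2 ≤ #A := by
    simpa using sum_le_card_nsmul A _ 1 fun i _ => (sq_le_one_iff_abs_le_one (a i)).2 (ha i)
  calc ⟪a, u⟫ ^ 2 ≤ (∑ i ∈ A, a i ^ 2) * ∑ i ∈ A, u i ^ 2 := by
        rw [hinner]
        exact sum_mul_sq_le_sq_mul_sq A _ _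
    _ ≤ #A * ‖u‖ ^ 2 := by
        rw [EuclideanSpace.real_norm_sq_eq]
        exact mul_le_mul hsq (sum_le_univ_sum_of_nonneg fun i => sq_nonneg (u i)) (by positivity)
          (by positivity)

theorem exists_submodule_supported_orthogonal (A : Finset α) (S : Finset (EuclideanSpace ℝ α)) :
    ∃ V : Submodule ℝ (EuclideanSpace ℝ α), #A ≤ Module.finrank ℝ V + #S ∧
      (∀ u ∈ V, ∀ i ∉ A, u i = 0) ∧ ∀ u ∈ V, ∀ v ∈ S, ⟪v, u⟫ = 0 := by
  classical
  let T := S ∪ Aᶜ.image fun i => EuclideanSpace.single i (1 : ℝ)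
  let V := (Submodule.span ℝ (T : Set (EuclideanSpace ℝ α)))ᗮ
  have horth (u) (hu : u ∈ V) (t) (ht : t ∈ T) : ⟪t, u⟫ = 0 :=
    (Submodule.mem_orthogonal _ _).1 hu t (Submodule.subset_span ht)
  refine ⟨V, ?_, fun u hu i hi => ?_, fun u hu v hv => horth u hu v (mem_union_left _ hv)⟩
  · have hV : Fintype.card α ≤ Module.finrank ℝ V + #T := by
      simpa using finrank_le_finrank_orthogonal_add_card T
    have hT : #T ≤ #S + #Aᶜ := (card_union_le _ _).trans (by gcongr; exact card_image_le)
    have hAc := card_add_card_compl A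
    omega
  · simpa [EuclideanSpace.inner_single_left] using
      horth u hu _ (mem_union_right _ (mem_image_of_mem _ (mem_compl.2 hi)))

theorem exists_unit_orthogonal_sum_mul_inner_sq_le {ι : Type*} [Fintype ι] {A : Finset α}
    {S : Finset (EuclideanSpace ℝ α)} {w : ι → ℝ} (hw : ∀ j, 0 ≤ w j)
    {a : ι → EuclideanSpace ℝ α} (ha : ∀ j i, |a j i| ≤ 1) (hA : A.Nonempty)
    (hS : 2 * #S ≤ #A) :
    ∃ u : EuclideanSpace ℝ α, ‖u‖ = 1 ∧ (∀ i ∉ A, u i = 0) ∧ (∀ v ∈ S, ⟪v, u⟫ = 0) ∧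
      ∑ j, w j * ⟪a j, u⟫ ^ 2 ≤ 2 * ∑ j, w j := by
  obtain ⟨V, hdim, hsupp, horth⟩ := exists_submodule_supported_orthogonal A S
  have hpos : 0 < Module.finrank ℝ V := by have := hA.card_pos; omega
  have : Nontrivial V := Module.finrank_pos_iff.1 hpos
  let f (j : ι) : StrongDual ℝ V := (innerSL ℝ (a j)).comp V.subtypeL
  have hf (j : ι) : ‖f j‖ ^ 2 ≤ 2 * Module.finrank ℝ V := by
    have hnorm : ‖f j‖ ≤ √(#A) := (f j).opNorm_le_bound (by positivity) fun u => by
      refine abs_le_of_sq_le_sq ?_ (by positivity)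
      rw [mul_pow, Real.sq_sqrt (by positivity)]
      exact inner_sq_le_card_mul_norm_sq (ha j) (hsupp u u.2)
    calc ‖f j‖ ^ 2 ≤ #A := (Real.le_sqrt (by positivity) (by positivity)).1 hnorm
      _ ≤ 2 * Module.finrank ℝ V := by
        have hcard : #A ≤ 2 * Module.finrank ℝ V := by omega
        exact_mod_cast hcard
  obtain ⟨u, hu, hmean⟩ := exists_norm_eq_one_finrank_mul_sum_le (w := w) f
  refine ⟨u, hu, hsupp u u.2, horth u u.2, ?_⟩
  refine le_of_mul_le_mul_left (hmean.trans ?_) (Nat.cast_pos.2 hpos)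
  calc ∑ j, w j * ‖f j‖ ^ 2 ≤ ∑ j, w j * (2 * Module.finrank ℝ V) :=
        sum_le_sum fun j _ => mul_le_mul_of_nonneg_left (hf j) (hw j)
    _ = Module.finrank ℝ V * (2 * ∑ j, w j) := by rw [← sum_mul]; ring

theorem norm_sq_le_card {x : EuclideanSpace ℝ α} (hx : ∀ i, |x i| ≤ 1) :
    ‖x‖ ^ 2 ≤ Fintype.card α := by
  rw [EuclideanSpace.real_norm_sq_eq]
  simpa using sum_le_card_nsmul univ _ 1 fun i _ => (sq_le_one_iff_abs_le_one (x i)).2 (hx i)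

/-- The coordinates of a point of the cube that are not yet signs; they are the ones that can still
be moved in both directions. -/
noncomputable def fractionalCoords (x : EuclideanSpace ℝ α) : Finset α := {i | |x i| < 1}

theorem mem_fractionalCoords {x : EuclideanSpace ℝ α} {i : α} :
    i ∈ fractionalCoords x ↔ |x i| < 1 := by
  simp [fractionalCoords]

theorem card_sub_norm_sq_eq_sum (x : EuclideanSpace ℝ α) :
    Fintype.card α - ‖x‖ ^ 2 = ∑ i, (1 - x i ^ 2) := by
  simp [EuclideanSpace.real_norm_sq_eq]

theorem card_sub_norm_sq_le (x : EuclideanSpace ℝ α) :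
    Fintype.card α - ‖x‖ ^ 2 ≤ #(fractionalCoords x) := by
  classical
  calc Fintype.card α - ‖x‖ ^ 2 = ∑ i, (1 - x i ^ 2) := card_sub_norm_sq_eq_sum x
    _ ≤ ∑ i, if i ∈ fractionalCoords x then (1 : ℝ) else 0 := by
        refine sum_le_sum fun i _ => ?_
        split_ifs with hi
        · linarith [sq_nonneg (x i)]
        · have hi' : 1 ≤ |x i| := not_lt.1 (mem_fractionalCoords.not.1 hi)
          linarith [(one_le_sq_iff_one_le_abs (x i)).2 hi']
    _ = #(fractionalCoords x) := by simp

theorem norm_sq_lt_card {x : EuclideanSpace ℝ α} (hx : ∀ i, |x i| ≤ 1)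
    (hfrac : (fractionalCoords x).Nonempty) : ‖x‖ ^ 2 < Fintype.card α := by
  obtain ⟨i, hi⟩ := hfrac
  rw [← sub_pos, card_sub_norm_sq_eq_sum]
  refine sum_pos' (fun k _ => ?_) ⟨i, mem_univ i, ?_⟩
  · exact sub_nonneg.2 ((sq_le_one_iff_abs_le_one _).2 (hx k))
  · exact sub_pos.2 ((sq_lt_one_iff_abs_lt_one _).2 (mem_fractionalCoords.1 hi))

theorem eventually_abs_add_smul_le_one {x u : EuclideanSpace ℝ α} (hx : ∀ i, |x i| ≤ 1)
    (hu : ∀ i ∉ fractionalCoords x, u i = 0) :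
    ∀ᶠ ε in 𝓝 (0 : ℝ), ∀ i, |(x + ε • u) i| ≤ 1 := by
  refine eventually_all.2 fun i => ?_
  by_cases hi : i ∈ fractionalCoords x
  · have hcont : ContinuousAt (fun ε : ℝ => |(x + ε • u) i|) 0 := by fun_prop
    exact (hcont.eventually_lt_const (by simpa using mem_fractionalCoords.1 hi)).mono
      fun ε => le_of_lt
  · exact Eventually.of_forall fun ε => by simpa [hu i hi] using hx i

theorem exists_signs_inner_le_inner_add {x : EuclideanSpace ℝ α} (hx : ∀ i, |x i| ≤ 1) :
    ∃ z : α → ℝ, (∀ i, z i = -1 ∨ z i = 1) ∧ ∀ a : EuclideanSpace ℝ α, (∀ i, |a i| ≤ 1) →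
      ∑ i, a i * z i ≤ ⟪a, x⟫ + #(fractionalCoords x) := by
  classical
  let z (i : α) : ℝ := if 0 ≤ x i then 1 else -1
  refine ⟨z, fun i => by grind, fun a ha => ?_⟩
  have hround (i : α) : |z i - x i| ≤ if i ∈ fractionalCoords x then 1 else 0 := by
    have hxi := hx i
    simp only [z, mem_fractionalCoords]
    grind
  have hterm (i : α) : a i * z i - a i * x i ≤ if i ∈ fractionalCoords x then 1 else 0 :=
    calc a i * z i - a i * x i ≤ |a i| * |z i - x i| := by
          rw [← mul_sub, ← abs_mul]
          exact le_abs_self _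
      _ ≤ |z i - x i| := mul_le_of_le_one_left (abs_nonneg _) (ha i)
      _ ≤ _ := hround i
  have hinner : ⟪a, x⟫ = ∑ i, a i * x i := by
    simp only [PiLp.inner_apply, RCLike.inner_apply, conj_trivial, mul_comm]
  rw [← sub_le_iff_le_add', hinner, ← sum_sub_distrib]
  exact (sum_le_sum fun i _ => hterm i).trans_eq (by simp)

end Cube

/-! ### Growing the norm below a rising barrier -/

section Potential

variable {ι : Type*} [Fintype ι]

theorem card_mul_sq_le_sum_sq {t : ι → ℝ} {δ : ℝ} (hδ : 0 ≤ δ) :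
    #{j | δ < t j} * δ ^ 2 ≤ ∑ j, t j ^ 2 := by
  calc #{j | δ < t j} * δ ^ 2 ≤ ∑ j with δ < t j, t j ^ 2 := by
        rw [← nsmul_eq_mul]
        refine card_nsmul_le_sum _ _ _ fun j hj => ?_
        exact pow_le_pow_left₀ hδ (mem_filter.1 hj).2.le 2
    _ ≤ ∑ j, t j ^ 2 := sum_le_univ_sum_of_nonneg fun j => sq_nonneg (t j)

theorem inv_sq_sub_inv_sq {s t : ℝ} (hs : s ≠ 0) (ht : t ≠ 0) :
    t⁻¹ ^ 2 - s⁻¹ ^ 2 =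
      (t - s) ^ 2 * (3 * s + 2 * (t - s)) * s⁻¹ ^ 3 * t⁻¹ ^ 2 - 2 * (t - s) * s⁻¹ ^ 3 := by
  field_simp
  ring

theorem eventually_forall_pos_and_sum_inv_sq_le {s v : ι → ℝ} {β : ℝ} (hs : ∀ j, 0 < s j)
    (hfirst : ∑ j, (s j)⁻¹ ^ 3 * v j = 0)
    (hsecond : 3 * ∑ j, (s j)⁻¹ ^ 4 * v j ^ 2 < 2 * β * ∑ j, (s j)⁻¹ ^ 3) :
    ∀ᶠ ε in 𝓝 (0 : ℝ), (∀ j, 0 < s j + ε * (β * ε - v j)) ∧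
      ∑ j, (s j + ε * (β * ε - v j))⁻¹ ^ 2 ≤ ∑ j, (s j)⁻¹ ^ 2 := by
  have hpos : ∀ᶠ ε in 𝓝 (0 : ℝ), ∀ j, 0 < s j + ε * (β * ε - v j) := by
    refine eventually_all.2 fun j => ?_
    have hcont : ContinuousAt (fun ε : ℝ => s j + ε * (β * ε - v j)) 0 := by fun_prop
    exact hcont.eventually_const_lt (by simpa using hs j)
  -- By `hfirst`, `R ε` is the increment of the sum divided by `ε ^ 2`.
  let R (ε : ℝ) : ℝ := ∑ j, ((β * ε - v j) ^ 2 * (3 * s j + 2 * (ε * (β * ε - v j))) *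
    (s j)⁻¹ ^ 3 * (s j + ε * (β * ε - v j))⁻¹ ^ 2 - 2 * β * (s j)⁻¹ ^ 3)
  have hRcont : ContinuousAt R 0 := by
    have hinv (j : ι) : ContinuousAt (fun ε : ℝ => (s j + ε * (β * ε - v j))⁻¹) 0 :=
      ContinuousAt.inv₀ (by fun_prop) (by simpa using (hs j).ne')
    fun_prop
  have hR0 : R 0 = 3 * ∑ j, (s j)⁻¹ ^ 4 * v j ^ 2 - 2 * β * ∑ j, (s j)⁻¹ ^ 3 := by
    simp only [R, mul_sum, ← sum_sub_distrib]
    refine sum_congr rfl fun j _ => ?_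
    have := (hs j).ne'
    simp only [mul_zero, zero_mul, add_zero, zero_sub]
    field_simp
  have hRneg : ∀ᶠ ε in 𝓝 (0 : ℝ), R ε < 0 := hRcont.eventually_lt_const (by linarith)
  filter_upwards [hpos, hRneg] with ε hε hRε
  have hincrement : ∑ j, (s j + ε * (β * ε - v j))⁻¹ ^ 2 - ∑ j, (s j)⁻¹ ^ 2 =
      ε ^ 2 * R ε + 2 * ε * ∑ j, (s j)⁻¹ ^ 3 * v j := by
    simp only [R, mul_sum, ← sum_sub_distrib, ← sum_add_distrib]
    refine sum_congr rfl fun j _ => ?_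
    rw [inv_sq_sub_inv_sq (hs j).ne' (hε j).ne']
    ring
  refine ⟨hε, ?_⟩
  rw [hfirst, mul_zero, add_zero] at hincrement
  linarith [mul_nonpos_of_nonneg_of_nonpos (sq_nonneg ε) hRε.le]

theorem four_mul_card_filter_le {t : ι → ℝ} {c : ℝ} (hc : 0 < c)
    (hsum : ∑ j, t j ^ 2 ≤ c⁻¹ ^ 2) {m : ℕ} (hm : m ≠ 0) :
    4 * #{j | 2 / (c * √m) < t j} ≤ m := by
  have hm0 : (0 : ℝ) < m := by positivity
  set δ := 2 / (c * √m) with hδ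
  have hδsq : δ ^ 2 = 4 / m * c⁻¹ ^ 2 := by
    rw [hδ, div_pow, mul_pow, Real.sq_sqrt hm0.le]
    field_simp
    norm_num
  have hmarkov : #{j | δ < t j} * (4 / m) * c⁻¹ ^ 2 ≤ 1 * c⁻¹ ^ 2 := by
    rw [one_mul, mul_assoc, ← hδsq]
    exact (card_mul_sq_le_sum_sq (by positivity)).trans hsum
  have hcount := le_of_mul_le_mul_right hmarkov (by positivity)
  rw [mul_div_assoc', div_le_one hm0, mul_comm] at hcount
  exact_mod_cast hcount

end Potential

section Barrier

variable {α ι : Type*} [Fintype α]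

theorem sub_div_two_mul_sqrt_le {y z : ℝ} (hy : 0 < y) (hz : 0 ≤ z) :
    (y - z) / (2 * √y) ≤ √y - √z := by
  rw [div_le_iff₀ (by positivity)]
  nlinarith [two_mul_le_add_sq (√y) (√z), Real.sq_sqrt hy.le, Real.sq_sqrt hz]

/-- The common upper barrier for the linear forms at the point `x` of the cube. It rises from `κ`
at the origin to `κ + K √n` at the vertices, where `n` is the dimension. -/
noncomputable def barrier (κ K : ℝ) (x : EuclideanSpace ℝ α) : ℝ :=
  κ + K * (√(Fintype.card α) - √(Fintype.card α - ‖x‖ ^ 2))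

/-- The amount by which the `j`-th linear form `⟪a j, ·⟫` stays below the barrier at `x`; the
potential of the argument is the sum of the inverse squares of these amounts. -/
noncomputable def slack (a : ι → EuclideanSpace ℝ α) (κ K : ℝ) (x : EuclideanSpace ℝ α) (j : ι) :
    ℝ :=
  barrier κ K x - ⟪a j, x⟫

theorem continuous_slack (a : ι → EuclideanSpace ℝ α) (κ K : ℝ) (j : ι) :
    Continuous fun x => slack a κ K x j := by
  unfold slack barrier
  fun_prop

theorem norm_sq_add_smul {x u : EuclideanSpace ℝ α} (hu : ‖u‖ = 1) (hxu : ⟪x, u⟫ = 0) (ε : ℝ) :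
    ‖x + ε • u‖ ^ 2 = ‖x‖ ^ 2 + ε ^ 2 := by
  rw [norm_add_sq_real, real_inner_smul_right, hxu, norm_smul, hu, mul_one, Real.norm_eq_abs,
    sq_abs]
  ring

theorem slack_add_smul_ge {a : ι → EuclideanSpace ℝ α} {κ K : ℝ} (hK : 0 ≤ K)
    {x u : EuclideanSpace ℝ α} (hu : ‖u‖ = 1) (hxu : ⟪x, u⟫ = 0)
    (hx : ‖x‖ ^ 2 < Fintype.card α) {ε : ℝ} (hε : ‖x + ε • u‖ ^ 2 ≤ Fintype.card α) (j : ι) :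
    slack a κ K x j + ε * (K / (2 * √(Fintype.card α - ‖x‖ ^ 2)) * ε - ⟪a j, u⟫) ≤
      slack a κ K (x + ε • u) j := by
  have hnorm := norm_sq_add_smul hu hxu ε
  have hsqrt := mul_le_mul_of_nonneg_left
    (sub_div_two_mul_sqrt_le (sub_pos.2 hx) (sub_nonneg.2 hε)) hK
  rw [hnorm] at hsqrt
  have hgain : K / (2 * √(Fintype.card α - ‖x‖ ^ 2)) * ε ^ 2 =
      K * ((Fintype.card α - ‖x‖ ^ 2 - (Fintype.card α - (‖x‖ ^ 2 + ε ^ 2))) /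
        (2 * √(Fintype.card α - ‖x‖ ^ 2))) := by ring
  unfold slack barrier
  rw [inner_add_right, real_inner_smul_right, hnorm]
  linarith

variable [Fintype ι]

theorem exists_unit_sum_pow_four_mul_inner_sq_le {t : ι → ℝ} (ht : ∀ j, 0 ≤ t j) {c : ℝ}
    (hc : 0 < c) (hsum : ∑ j, t j ^ 2 ≤ c⁻¹ ^ 2) {a : ι → EuclideanSpace ℝ α}
    (ha : ∀ j i, |a j i| ≤ 1) {A : Finset α} (hA : 8 ≤ #A) (x : EuclideanSpace ℝ α) :
    ∃ u : EuclideanSpace ℝ α, ‖u‖ = 1 ∧ (∀ i ∉ A, u i = 0) ∧ ⟪x, u⟫ = 0 ∧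
      ∑ j, t j ^ 3 * ⟪a j, u⟫ = 0 ∧
      ∑ j, t j ^ 4 * ⟪a j, u⟫ ^ 2 ≤ 4 / (c * √(#A)) * ∑ j, t j ^ 3 := by
  classical
  set δ := 2 / (c * √(#A)) with hδ
  let H : Finset ι := {j | δ < t j}
  have hH : 4 * #H ≤ #A := four_mul_card_filter_le hc hsum (by omega)
  let S := {x, ∑ j, t j ^ 3 • a j} ∪ H.image a
  have hS : 2 * #S ≤ #A := by
    have hunion : #S ≤ #{x, ∑ j, t j ^ 3 • a j} + #(H.image a) := card_union_le _ _
    have hpair : #{x, ∑ j, t j ^ 3 • a j} ≤ 2 := card_le_two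
    have himage : #(H.image a) ≤ #H := card_image_le
    omega
  obtain ⟨u, hu, hsupp, horth, hmean⟩ := exists_unit_orthogonal_sum_mul_inner_sq_le
    (fun j => pow_nonneg (ht j) 3) ha (card_pos.1 (by omega)) hS
  refine ⟨u, hu, hsupp, horth x (by simp [S]), ?_, ?_⟩
  · simpa only [sum_inner, real_inner_smul_left] using
      horth (∑ j, t j ^ 3 • a j) (by simp [S])
  · have hterm (j : ι) : t j ^ 4 * ⟪a j, u⟫ ^ 2 ≤ δ * (t j ^ 3 * ⟪a j, u⟫ ^ 2) := by
      by_cases hj : j ∈ H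
      · simp [horth (a j) (mem_union_right _ (mem_image_of_mem a hj))]
      · have hlight : t j ≤ δ := by simpa [H] using hj
        have hnonneg : 0 ≤ t j ^ 3 * ⟪a j, u⟫ ^ 2 :=
          mul_nonneg (pow_nonneg (ht j) 3) (sq_nonneg _)
        linarith [mul_le_mul_of_nonneg_right hlight hnonneg]
    calc ∑ j, t j ^ 4 * ⟪a j, u⟫ ^ 2 ≤ δ * ∑ j, t j ^ 3 * ⟪a j, u⟫ ^ 2 := by
          rw [mul_sum]
          exact sum_le_sum fun j _ => hterm j
      _ ≤ δ * (2 * ∑ j, t j ^ 3) := by gcongr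
      _ = 4 / (c * √(#A)) * ∑ j, t j ^ 3 := by rw [hδ]; ring

/-- The points of the cube `[-1, 1]ⁿ` at which every linear form stays below the barrier by at least
`c` and the inverse-square potential of the slacks is at most `c⁻²`. The first condition follows
from the second for positive slacks; it is included so that the set is visibly closed. -/
def admissibleSet (a : ι → EuclideanSpace ℝ α) (κ K c : ℝ) : Set (EuclideanSpace ℝ α) :=
  {x | (∀ i, |x i| ≤ 1) ∧ (∀ j, c ≤ slack a κ K x j) ∧
    ∑ j, (slack a κ K x j)⁻¹ ^ 2 ≤ c⁻¹ ^ 2}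

variable {a : ι → EuclideanSpace ℝ α} {κ K c : ℝ} {x : EuclideanSpace ℝ α}

theorem mem_admissibleSet_of_slack_pos (hc : 0 < c) (hx : ∀ i, |x i| ≤ 1)
    (hslack : ∀ j, 0 < slack a κ K x j) (hpot : ∑ j, (slack a κ K x j)⁻¹ ^ 2 ≤ c⁻¹ ^ 2) :
    x ∈ admissibleSet a κ K c := by
  refine ⟨hx, fun j => ?_, hpot⟩
  have hj : (slack a κ K x j)⁻¹ ^ 2 ≤ c⁻¹ ^ 2 :=
    (single_le_sum (fun k _ => sq_nonneg (slack a κ K x k)⁻¹) (mem_univ j)).trans hpot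
  exact (inv_le_inv₀ (hslack j) hc).1 (le_of_sq_le_sq hj (inv_nonneg.2 hc.le))

theorem zero_mem_admissibleSet (hκ : 0 < κ) (hc : 0 < c)
    (hcard : Fintype.card ι * c ^ 2 ≤ κ ^ 2) : 0 ∈ admissibleSet a κ K c := by
  have hslack (j : ι) : slack a κ K 0 j = κ := by simp [slack, barrier]
  refine mem_admissibleSet_of_slack_pos hc (by simp) (fun j => by rwa [hslack]) ?_
  simp only [hslack, sum_const, card_univ, nsmul_eq_mul]
  field_simp
  exact hcard

theorem isCompact_admissibleSet (hc : 0 < c) : IsCompact (admissibleSet a κ K c) := by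
  have hcube : IsClosed {x : EuclideanSpace ℝ α | ∀ i, |x i| ≤ 1} := by
    simp only [Set.ofPred_forall]
    exact isClosed_iInter fun i => isClosed_le (by fun_prop) continuous_const
  have hslack : IsClosed {x | ∀ j, c ≤ slack a κ K x j} := by
    simp only [Set.ofPred_forall]
    exact isClosed_iInter fun j => isClosed_le continuous_const (continuous_slack a κ K j)
  have hpot : ContinuousOn (fun x => ∑ j, (slack a κ K x j)⁻¹ ^ 2)
      {x | ∀ j, c ≤ slack a κ K x j} :=
    continuousOn_finsetSum _ fun j _ => ((continuous_slack a κ K j).continuousOn.inv₀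
      fun y (hy : ∀ j, c ≤ slack a κ K y j) => (hc.trans_le (hy j)).ne').pow 2
  have hclosed : IsClosed (admissibleSet a κ K c) :=
    hcube.inter (hslack.isClosed_le hpot continuousOn_const)
  refine (isCompact_closedBall 0 √(Fintype.card α)).of_isClosed_subset hclosed fun x hx => ?_
  rw [mem_closedBall_zero_iff]
  exact Real.le_sqrt_of_sq_le (norm_sq_le_card hx.1)

theorem twelve_div_mul_sqrt_lt_div_sqrt (hx : ∀ i, |x i| ≤ 1)
    (hfrac : (fractionalCoords x).Nonempty) (hc : 0 < c) (hKc : 12 < K * c) :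
    12 / (c * √(#(fractionalCoords x))) < K / √(Fintype.card α - ‖x‖ ^ 2) := by
  have hK : 0 < K := pos_of_mul_pos_left (by linarith) hc.le
  have hq : 0 < √(Fintype.card α - ‖x‖ ^ 2) :=
    Real.sqrt_pos.2 (sub_pos.2 (norm_sq_lt_card hx hfrac))
  have hqr : √(Fintype.card α - ‖x‖ ^ 2) ≤ √(#(fractionalCoords x)) :=
    Real.sqrt_le_sqrt (card_sub_norm_sq_le x)
  calc 12 / (c * √(#(fractionalCoords x))) < K * c / (c * √(#(fractionalCoords x))) :=
        div_lt_div_of_pos_right hKc (mul_pos hc (hq.trans_le hqr))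
    _ = K / √(#(fractionalCoords x)) := by rw [mul_comm K, mul_div_mul_left _ _ hc.ne']
    _ ≤ K / √(Fintype.card α - ‖x‖ ^ 2) := by gcongr

theorem exists_mem_admissibleSet_norm_gt [Nonempty ι] (ha : ∀ j i, |a j i| ≤ 1) (hc : 0 < c)
    (hKc : 12 < K * c) (hx : x ∈ admissibleSet a κ K c) (hfrac : 8 ≤ #(fractionalCoords x)) :
    ∃ y ∈ admissibleSet a κ K c, ‖x‖ < ‖y‖ := by
  have hK : 0 ≤ K := (pos_of_mul_pos_left (by linarith) hc.le).le
  obtain ⟨hcube, hslack, hpot⟩ := hx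
  have hpos (j : ι) : 0 < slack a κ K x j := hc.trans_le (hslack j)
  have hlt : ‖x‖ ^ 2 < Fintype.card α := norm_sq_lt_card hcube (card_pos.1 (by omega))
  obtain ⟨u, hu, hsupp, hxu, hfirst, hcurv⟩ := exists_unit_sum_pow_four_mul_inner_sq_le
    (fun j => (inv_pos.2 (hpos j)).le) hc hpot ha hfrac x
  set β := K / (2 * √(Fintype.card α - ‖x‖ ^ 2)) with hβ
  have hsecond : 3 * ∑ j, (slack a κ K x j)⁻¹ ^ 4 * ⟪a j, u⟫ ^ 2 <
      2 * β * ∑ j, (slack a κ K x j)⁻¹ ^ 3 := by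
    have hW : 0 < ∑ j, (slack a κ K x j)⁻¹ ^ 3 :=
      sum_pos (fun j _ => pow_pos (inv_pos.2 (hpos j)) 3) univ_nonempty
    calc 3 * ∑ j, (slack a κ K x j)⁻¹ ^ 4 * ⟪a j, u⟫ ^ 2
        ≤ 3 * (4 / (c * √(#(fractionalCoords x))) * ∑ j, (slack a κ K x j)⁻¹ ^ 3) := by gcongr
      _ = 12 / (c * √(#(fractionalCoords x))) * ∑ j, (slack a κ K x j)⁻¹ ^ 3 := by ring
      _ < K / √(Fintype.card α - ‖x‖ ^ 2) * ∑ j, (slack a κ K x j)⁻¹ ^ 3 := by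
        refine mul_lt_mul_of_pos_right ?_ hW
        exact twelve_div_mul_sqrt_lt_div_sqrt hcube (card_pos.1 (by omega)) hc hKc
      _ = 2 * β * ∑ j, (slack a κ K x j)⁻¹ ^ 3 := by rw [hβ]; ring
  have hlocal := (eventually_forall_pos_and_sum_inv_sq_le hpos hfirst hsecond).and
    (eventually_abs_add_smul_le_one hcube hsupp)
  obtain ⟨ε, ⟨⟨hεpos, hεpot⟩, hεcube⟩, hε⟩ := ((hlocal.filter_mono nhdsWithin_le_nhds).and
    (self_mem_nhdsWithin (a := (0 : ℝ)) (s := Set.Ioi 0))).exists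
  have hmono := slack_add_smul_ge (a := a) (κ := κ) hK hu hxu hlt (norm_sq_le_card hεcube)
  refine ⟨x + ε • u, mem_admissibleSet_of_slack_pos hc hεcube
    (fun j => (hεpos j).trans_le (hmono j)) ?_, ?_⟩
  · refine (sum_le_sum fun j _ => ?_).trans (hεpot.trans hpot)
    exact pow_le_pow_left₀ (inv_pos.2 ((hεpos j).trans_le (hmono j))).le
      (inv_anti₀ (hεpos j) (hmono j)) 2
  · refine lt_of_pow_lt_pow_left₀ 2 (norm_nonneg _) ?_
    rw [norm_sq_add_smul hu hxu]
    exact lt_add_of_pos_right _ (pow_pos hε 2)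

theorem exists_cube_point_inner_le [Nonempty ι] (ha : ∀ j i, |a j i| ≤ 1) (hκ : 0 < κ)
    (hc : 0 < c) (hKc : 12 < K * c) (hcard : Fintype.card ι * c ^ 2 ≤ κ ^ 2) :
    ∃ x : EuclideanSpace ℝ α, (∀ i, |x i| ≤ 1) ∧ #(fractionalCoords x) < 8 ∧
      ∀ j, ⟪a j, x⟫ ≤ κ + K * √(Fintype.card α) := by
  obtain ⟨x, hx, hmax⟩ := (isCompact_admissibleSet hc).exists_isMaxOn
    ⟨0, zero_mem_admissibleSet (a := a) (K := K) hκ hc hcard⟩ continuous_norm.continuousOn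
  refine ⟨x, hx.1, ?_, fun j => ?_⟩
  · by_contra! hfrac
    obtain ⟨y, hy, hxy⟩ := exists_mem_admissibleSet_norm_gt ha hc hKc hx hfrac
    exact (hmax hy).not_gt hxy
  · have hslack : 0 ≤ slack a κ K x j := hc.le.trans (hx.2.1 j)
    have hK : 0 < K := pos_of_mul_pos_left (by linarith) hc.le
    have hsqrt : 0 ≤ K * √(Fintype.card α - ‖x‖ ^ 2) := by positivity
    unfold slack barrier at hslack
    linarith

theorem exists_signs_abs_sum_le [Nonempty ι] {b : ι → α → ℝ} (hb : ∀ j i, |b j i| ≤ 1)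
    (hκ : 0 < κ) (hc : 0 < c) (hKc : 12 < K * c)
    (hcard : 2 * Fintype.card ι * c ^ 2 ≤ κ ^ 2) :
    ∃ z : α → ℝ, (∀ i, z i = -1 ∨ z i = 1) ∧
      ∀ j, |∑ i, z i * b j i| ≤ κ + K * √(Fintype.card α) + 8 := by
  let a : ι ⊕ ι → EuclideanSpace ℝ α :=
    Sum.elim (fun j => WithLp.toLp 2 (b j)) fun j => WithLp.toLp 2 (-b j)
  have ha : ∀ j i, |a j i| ≤ 1 := by rintro (j | j) i <;> simpa [a] using hb j i
  obtain ⟨x, hx, hfrac, hinner⟩ := exists_cube_point_inner_le ha hκ hc hKc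
    (by rwa [Fintype.card_sum, Nat.cast_add, ← two_mul])
  obtain ⟨z, hz, hround⟩ := exists_signs_inner_le_inner_add hx
  have hsum (j : ι ⊕ ι) : ∑ i, a j i * z i ≤ κ + K * √(Fintype.card α) + 8 := by
    have hfrac' : (#(fractionalCoords x) : ℝ) ≤ 8 := mod_cast hfrac.le
    linarith [hround (a j) (ha j), hinner j]
  refine ⟨z, hz, fun j => abs_le'.2 ⟨?_, ?_⟩⟩
  · simpa [a, mul_comm] using hsum (.inl j)
  · simpa [a, mul_comm] using hsum (.inr j)

end Barrier

/-! ### Chebyshev norms -/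

theorem abs_eval_le_chebyshevNorm (p : ℝ[X]) {x : ℝ} (hx : |x| ≤ 1) :
    |p.eval x| ≤ chebyshevNorm p :=
  le_csSup (bddAbove_abs_eval p) ⟨x, hx, rfl⟩

theorem chebyshevNorm_le {p : ℝ[X]} {M : ℝ} (hM : ∀ x, |x| ≤ 1 → |p.eval x| ≤ M) :
    chebyshevNorm p ≤ M := by
  refine csSup_le ⟨_, 0, by simp, rfl⟩ ?_
  rintro _ ⟨x, hx, rfl⟩
  exact hM x hx

theorem chebyshevNorm_le_sqrt_two_mul {n : ℕ} (hn : n ≠ 0) {p : ℝ[X]} (hp : p.natDegree ≤ n)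
    {M : ℝ} (hM : ∀ j < 4 * n, |p.eval (Real.cos (2 * Real.pi * j / (4 * n : ℕ)))| ≤ M) :
    chebyshevNorm p ≤ √2 * M := by
  have hM0 : 0 ≤ M := (abs_nonneg _).trans (hM 0 (by omega))
  refine chebyshevNorm_le fun x hx => abs_le_of_sq_le_sq ?_ (by positivity)
  have hsq := mul_sq_eval_le_of_cos_nodes (L := 2 * n) (by omega) (by omega) hp hM hx
  have hn0 : (0 : ℝ) < 2 * n := by positivity
  rw [mul_pow, Real.sq_sqrt zero_le_two]
  refine le_of_mul_le_mul_left ?_ hn0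
  push_cast at hsq
  linarith

theorem theorem1 (n : ℕ) (hn : 1 ≤ n) (p : Fin n → Polynomial ℝ)
    (hdeg : ∀ i, (p i).natDegree ≤ n) (hp : ∀ i, chebyshevNorm (p i) ≤ 1) :
    ∃ x : Fin n → ℝ, (∀ i, x i = -1 ∨ x i = 1) ∧
      chebyshevNorm (∑ i, x i • p i) < 30 * Real.sqrt (n : ℝ) := by
  have hn0 : n ≠ 0 := by omega
  have : Nonempty (Fin (4 * n)) := ⟨⟨0, by omega⟩⟩
  have hsq : √(n : ℝ) ^ 2 = n := Real.sq_sqrt n.cast_nonneg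
  have hone : 1 ≤ √(n : ℝ) := Real.one_le_sqrt.2 (mod_cast hn)
  -- `κ ≥ c √(8 n)` and `K > 12 / c` force `κ + K √n ≥ (√8 c + 12 / c) √n`, least near `c = 2.06`.
  obtain ⟨x, hx, hbound⟩ := exists_signs_abs_sum_le (κ := 6 * √n) (K := 6) (c := 2.1)
    (b := fun (j : Fin (4 * n)) i => (p i).eval (Real.cos (2 * Real.pi * j / (4 * n : ℕ))))
    (fun j i => (abs_eval_le_chebyshevNorm (p i) (Real.abs_cos_le_one _)).trans (hp i))
    (by positivity) (by norm_num) (by norm_num)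
    (by rw [Fintype.card_fin, mul_pow, hsq]; push_cast; linarith)
  have hdegree : (∑ i, x i • p i).natDegree ≤ n :=
    natDegree_sum_le_of_forall_le _ _ fun i _ => (natDegree_smul_le _ _).trans (hdeg i)
  have hnodes : ∀ j < 4 * n,
      |(∑ i, x i • p i).eval (Real.cos (2 * Real.pi * j / (4 * n : ℕ)))| ≤ 20 * √n := by
    intro j hj
    have hj' := hbound ⟨j, hj⟩
    simp only [eval_finsetSum, eval_smul, smul_eq_mul, Fintype.card_fin] at hj' ⊢
    linarith
  have hsqrt : √(2 : ℝ) < 3 / 2 := (Real.sqrt_lt' (by norm_num)).2 (by norm_num)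
  refine ⟨x, hx, (chebyshevNorm_le_sqrt_two_mul hn0 hdegree hnodes).trans_lt ?_⟩
  linarith [mul_lt_mul_of_pos_right hsqrt (show 0 < 20 * √(n : ℝ) by positivity)]
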